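/- Let $I\subset\mathbb R$ be an open interval, $h:I\to(0,\infty)$ a smooth function, $(P^n,g_0)$ a smooth Riemannian manifold, and let $\bar M^{n+1}=I\times_h P$ be the warped product, that is, $I\times P$ with the metric $\bar g=\langle\cdot,\cdot\rangle=dt^2+h(t)^2g_0$. Let $X=h(t)\partial_t$ and let $\pi:\bar M\to I$, $\pi(t,p)=t$. Let $M^m$ be a smooth Riemannian manifold and let $\psi:M\to\bar M$ be a smooth isometric immersion which is a mean curvature flow soliton with respect to $X$ with constant $c\in\mathbb R$, that is, $c\,X^\perp=\mathbf H$ along $\psi$, where $\perp$ is the projection onto the normal bundle of $\psi$ and $\mathbf H$ is the non-normalized mean curvature vector (the trace of the second fundamental form of $\psi$ with respect to the induced metric). Fix $t_0\in I$ and define on $M$ the functions $$\eta(x)=\int_{t_0}^{\pi(\psi(x))}h(s)\,ds,\qquad \varphi(x)=\Big(\frac1{n+1}\operatorname{div}_{\bar M}X\Big)(\psi(x)).$$ Let $\Delta$ be the Laplace–Beltrami operator of $M$ (the trace of the Hessian), and for functions $\zeta,u$ on $M$ put $\Delta_\zeta u=\Delta u-\langle\nabla\zeta,\nabla u\rangle$.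 Then, on $M$, if $c\neq0$, $$\Delta\eta=m\varphi+\frac1c|\mathbf H|^2=m\,h'(\pi\circ\psi)+\frac1c|\mathbf H|^2,$$ and, for every $c$, $$\Delta_{-c\eta}\eta=m\varphi+c|X|^2=m\,h'(\pi\circ\psi)+c\,h(\pi\circ\psi)^2 .$$ Manifolds are without boundary. -/

import Mathlib

open Set MeasureTheory TopologicalSpace
open scoped Manifold ContDiff Bundle Topology

namespace MCFSoliton

noncomputable section

/-! ### Riemannian geometry in charts

All manifolds are without boundary.  The tangent space at `p` is the model vector space, a tangent
vector being identified with its components in the preferred chart `extChartAt J p` at `p`. -/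

section Riemannian

variable {E : Type*} [NormedAddCommGroup E] [NormedSpace ℝ E] [FiniteDimensional ℝ E]
  {H : Type*} [TopologicalSpace H] (I : ModelWithCorners ℝ E H)
  {M : Type*} [TopologicalSpace M] [ChartedSpace H M]
  {F : Type*} [NormedAddCommGroup F] [NormedSpace ℝ F] [FiniteDimensional ℝ F]
  {G : Type*} [TopologicalSpace G] (J : ModelWithCorners ℝ F G)
  {N : Type*} [TopologicalSpace N] [ChartedSpace G N]

/-- Fields of bilinear forms on the tangent spaces of `N`. -/
abbrev MetricTensor (N : Type*) [TopologicalSpace N] [ChartedSpace G N] :=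
  ∀ p : N, TangentSpace J p →L[ℝ] TangentSpace J p →L[ℝ] ℝ

/-- Raising an index with an inner product `B`: `sharp B α` is the vector `w` with
`B w = α`. -/
def sharp {V : Type*} [AddCommGroup V] [Module ℝ V] [TopologicalSpace V]
    [IsTopologicalAddGroup V] [ContinuousSMul ℝ V] (B : V →L[ℝ] V →L[ℝ] ℝ) (α : V →L[ℝ] ℝ) : V :=
  B.inverse α

/-- The bilinear form `(u, v) ↦ B (A u) (A v)`. -/
def pullBilin {U V : Type*} [AddCommGroup U] [Module ℝ U] [TopologicalSpace U]
    [IsTopologicalAddGroup U] [ContinuousSMul ℝ U] [AddCommGroup V] [Module ℝ V]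
    [TopologicalSpace V] [IsTopologicalAddGroup V] [ContinuousSMul ℝ V]
    (B : V →L[ℝ] V →L[ℝ] ℝ) (A : U →L[ℝ] V) : U →L[ℝ] U →L[ℝ] ℝ :=
  (ContinuousLinearMap.precomp ℝ A).comp (B.comp A)

/-- The trace `∑ Bᵃᵇ Q (e_a) (e_b)` of a bilinear map `Q` with respect to an inner product `B`.
Here `∑_b Bᵃᵇ e_b` is the vector obtained from the dual basis covector `eᵃ` by raising
the index. -/
def metricTrace {W : Type*} [AddCommGroup W] (B : F →L[ℝ] F →L[ℝ] ℝ) (Q : F → F → W) : W :=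
  ∑ a, Q (Module.finBasis ℝ F a)
    (sharp B (LinearMap.toContinuousLinearMap ((Module.finBasis ℝ F).coord a)))

/-- The components `g_ij` of `g` in the preferred chart at `p`: at the point with coordinates `y`,
the value of `g` on the coordinate vectors. -/
def chartMetric (g : MetricTensor J N) (p : N) (y : F) : F →L[ℝ] F →L[ℝ] ℝ :=
  pullBilin (g ((extChartAt J p).symm y)) (mfderiv 𝓘(ℝ, F) J (extChartAt J p).symm y)

/-- The Christoffel symbols `Γ(u, v)` at `y` of a metric `γ` on an open subset of a vector space:
`γ(Γ(u, v), w) = (∂_u γ(v, w) + ∂_v γ(u, w) - ∂_w γ(u, v)) / 2` for all `w`. -/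
def christoffel (γ : F → F →L[ℝ] F →L[ℝ] ℝ) (y u v : F) : F :=
  sharp (γ y) ((1 / 2 : ℝ) •
    (fderiv ℝ γ y u v + fderiv ℝ γ y v u - ((fderiv ℝ γ y).flip u).flip v))

/-- The Levi-Civita covariant derivative `∇_u X` at `p`. -/
def covDeriv (g : MetricTensor J N) (X : ∀ p : N, TangentSpace J p) (p : N)
    (u : TangentSpace J p) : TangentSpace J p :=
  fderiv ℝ (fun y : F ↦ mfderiv J 𝓘(ℝ, F) (extChartAt J p) ((extChartAt J p).symm y)
      (X ((extChartAt J p).symm y))) (extChartAt J p p) u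
    + christoffel (chartMetric J g p) (extChartAt J p p) u (X p)

/-- The divergence of a vector field, the trace of `u ↦ ∇_u X`. -/
def divergence (g : MetricTensor J N) (X : ∀ p : N, TangentSpace J p) (p : N) : ℝ :=
  ∑ a, (Module.finBasis ℝ F).coord a (covDeriv J g X p (Module.finBasis ℝ F a))

/-- The gradient of a function. -/
def grad (g : MetricTensor J N) (f : N → ℝ) (p : N) : TangentSpace J p :=
  sharp (g p) (mfderiv J 𝓘(ℝ, ℝ) f p)

/-- The Riemannian Hessian `∇df(u, v)` at `p`. -/
def hessian (g : MetricTensor J N) (f : N → ℝ) (p : N) (u v : TangentSpace J p) : ℝ :=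
  fderiv ℝ (fderiv ℝ (f ∘ (extChartAt J p).symm)) (extChartAt J p p) u v
    - fderiv ℝ (f ∘ (extChartAt J p).symm) (extChartAt J p p)
        (christoffel (chartMetric J g p) (extChartAt J p p) u v)

/-- The Laplace-Beltrami operator. -/
def laplacian (g : MetricTensor J N) (f : N → ℝ) (p : N) : ℝ :=
  metricTrace (F := F) (g p) (hessian J g f p)

/-- The weighted Laplacian `Δ_ζ f = Δ f - ⟨∇ζ, ∇f⟩`. -/
def weightedLaplacian (g : MetricTensor J N) (ζ f : N → ℝ) (p : N) : ℝ :=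
  laplacian J g f p - g p (grad J g ζ p) (grad J g f p)

/-! ### Submanifold geometry of a map `ψ : M → N` into a Riemannian manifold `(N, g)` -/

/-- The pulled back metric `ψ^* g`. -/
def inducedMetric (g : MetricTensor J N) (ψ : M → N) : MetricTensor I M := fun x ↦
  pullBilin (g (ψ x)) (mfderiv I J ψ x)

/-- A smooth map `ψ : (M, gM) → (N, g)` with `ψ^* g = gM`.  As `gM` is positive definite in all
uses, the differential of `ψ` is then injective. -/
def IsIsometricImmersion (gM : MetricTensor I M) (g : MetricTensor J N) (ψ : M → N) : Prop :=
  ContMDiff I J ∞ ψ ∧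
    ∀ (x : M) (u v : TangentSpace I x), g (ψ x) (mfderiv I J ψ x u) (mfderiv I J ψ x v) = gM x u v

/-- The tangential projection of a vector `w` at `ψ x`: the vector `dψ(T)` such that
`⟨dψ(T), dψ(u)⟩ = ⟨w, dψ(u)⟩` for all `u`. -/
def tangentialPart (g : MetricTensor J N) (ψ : M → N) (x : M) (w : TangentSpace J (ψ x)) :
    TangentSpace J (ψ x) :=
  mfderiv I J ψ x (sharp (inducedMetric I J g ψ x) ((g (ψ x) w).comp (mfderiv I J ψ x)))

/-- The normal projection of a vector `w` at `ψ x`. -/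
def normalPart (g : MetricTensor J N) (ψ : M → N) (x : M) (w : TangentSpace J (ψ x)) :
    TangentSpace J (ψ x) :=
  w - tangentialPart I J g ψ x w

/-- The covariant derivative `∇_{dψ U} (dψ V)` at `x`, for the vector fields `U`, `V` near `x`
which have constant components `u`, `v` in the preferred chart at `x`; in coordinates,
`∂_a ∂_b ψᵏ + Γᵏ_ij ∂_a ψⁱ ∂_b ψʲ`. -/
def covDerivPush (g : MetricTensor J N) (ψ : M → N) (x : M) (u v : TangentSpace I x) :
    TangentSpace J (ψ x) :=
  fderiv ℝ (fderiv ℝ (writtenInExtChartAt I J x ψ)) (extChartAt I x x) u v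
    + christoffel (chartMetric J g (ψ x)) (extChartAt J (ψ x) (ψ x))
        (mfderiv I J ψ x u) (mfderiv I J ψ x v)

/-- The second fundamental form `II(u, v) = (∇_{dψ U} (dψ V))^⊥`. -/
def secondFundamentalForm (g : MetricTensor J N) (ψ : M → N) (x : M) (u v : TangentSpace I x) :
    TangentSpace J (ψ x) :=
  normalPart I J g ψ x (covDerivPush I J g ψ x u v)

/-- The (non-normalized) mean curvature vector, the trace of the second fundamental form with
respect to the induced metric. -/
def meanCurvature (g : MetricTensor J N) (ψ : M → N) (x : M) : TangentSpace J (ψ x) :=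
  metricTrace (F := E) (inducedMetric I J g ψ x) (secondFundamentalForm I J g ψ x)

/-- `ψ` is a mean curvature flow soliton with respect to the vector field `X`, with constant `c`. -/
def IsMCFSoliton (gM : MetricTensor I M) (g : MetricTensor J N) (ψ : M → N)
    (X : ∀ q : N, TangentSpace J q) (c : ℝ) : Prop :=
  IsIsometricImmersion I J gM g ψ ∧
    ∀ x : M, c • normalPart I J g ψ x (X (ψ x)) = meanCurvature I J g ψ x

end Riemannian

/-! ### Warped products -/

section Warped

variable {n : ℕ} {P : Type*} [TopologicalSpace P] [ChartedSpace (EuclideanSpace ℝ (Fin n)) P]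

/-- The model of the product `T × P` of an interval and an `n`-manifold. -/
abbrev warpedModel (n : ℕ) : ModelWithCorners ℝ (ℝ × EuclideanSpace ℝ (Fin n))
    (ModelProd ℝ (EuclideanSpace ℝ (Fin n))) :=
  𝓘(ℝ, ℝ).prod 𝓘(ℝ, EuclideanSpace ℝ (Fin n))

/-- The warped metric `dt² + h(t)² g₀` on `T × P`, with `T` an open subset of the line. -/
def warpedMetric (T : Opens ℝ) (h : ℝ → ℝ) (g₀ : MetricTensor 𝓘(ℝ, EuclideanSpace ℝ (Fin n)) P) :
    MetricTensor (warpedModel n) (T × P) := fun q ↦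
  letI dt : TangentSpace (warpedModel n) q →L[ℝ] ℝ :=
    ContinuousLinearMap.fst ℝ ℝ (EuclideanSpace ℝ (Fin n))
  letI dp : TangentSpace (warpedModel n) q →L[ℝ]
      TangentSpace 𝓘(ℝ, EuclideanSpace ℝ (Fin n)) q.2 :=
    ContinuousLinearMap.snd ℝ ℝ (EuclideanSpace ℝ (Fin n))
  pullBilin (ContinuousLinearMap.mul ℝ ℝ) dt + (h q.1 ^ 2) • pullBilin (g₀ q.2) dp

/-- The vector field `X = h(t) ∂_t` on `T × P`. -/
def warpedField (T : Opens ℝ) (h : ℝ → ℝ) (q : T × P) : TangentSpace (warpedModel n) q :=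
  (h q.1, (0 : EuclideanSpace ℝ (Fin n)))

/-- The function `η = ∫_{t₀}^{t ∘ ψ} h`. -/
def heightIntegral {M : Type*} {T : Opens ℝ} (h : ℝ → ℝ) (t₀ : T) (ψ : M → T × P) (x : M) : ℝ :=
  ∫ s in (t₀ : ℝ)..((ψ x).1 : ℝ), h s

/-- The function `φ = (div X / (n + 1)) ∘ ψ` with `X = h(t) ∂_t`. -/
def conformalFactor {M : Type*} {T : Opens ℝ} (h : ℝ → ℝ)
    (g₀ : MetricTensor 𝓘(ℝ, EuclideanSpace ℝ (Fin n)) P) (ψ : M → T × P) (x : M) : ℝ :=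
  1 / ((n : ℝ) + 1) *
    divergence (warpedModel n) (warpedMetric T h g₀) (warpedField T h) (ψ x)

end Warped

end

end MCFSoliton

open MCFSoliton

/-!
In the chart of `M` at `x` and the product chart of `T × P` at `ψ x`, everything is a computation
with Christoffel symbols. The field `X = h ∂_t` satisfies `∇_u X = h' u` (`covDeriv_warpedField`),
so its divergence is `(n + 1) h'` and `φ = h' ∘ π ∘ ψ`; also `η = Φ ∘ π ∘ ψ` with `Φ' = h`, so
that `dη(v) = ⟨X, dψ v⟩`. In other words `dψ (∇η)` is the tangential part of `X`
(`tangentialPart_warpedField`).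

Differentiating once more gives `Hess η = h' gM + ⟨II, X⟩` (`hessian_heightIntegral`). Two facts
enter. The Gauss formula: the metric of `M` is the pulled back one near `x`, so the Koszul formula
identifies the Levi-Civita connection of `M` with the tangential part of the connection of `T × P`
(`apply_christoffel_pullBilin`, `IsIsometricImmersion.tangentialPart_covDerivPush`). And
`Γᵗ(u, v) = -h h' γ₀(u, v)` (`christoffel_warped_fst`), by which the `∂_t`-component of `II`
produces exactly the fibre part `h² γ₀` of the metric. Taking traces, `Δη = m h' + ⟨H, X⟩`
(`laplacian_heightIntegral`).

For a soliton `H = c X^⊥`, hence `⟨H, X⟩ = c |X^⊥|²`, which is `|H|² / c` if `c ≠ 0`. The drift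
term `c |∇η|² = c |X^⊤|²` completes `c |X^⊥|²` to `c |X|² = c h²`.
-/

namespace MCFSoliton

/-! ### Musical isomorphisms and traces -/

section LinearAlgebra

variable {V : Type*} [NormedAddCommGroup V] [NormedSpace ℝ V] [FiniteDimensional ℝ V]

lemma isInvertible_of_forall_eq_zero {B : V →L[ℝ] V →L[ℝ] ℝ} (hB : ∀ v, B v = 0 → v = 0) :
    B.IsInvertible := by
  have hinj : Function.Injective B.toLinearMap :=
    (injective_iff_map_eq_zero B.toLinearMap).2 hB
  have hrank : Module.finrank ℝ V = Module.finrank ℝ (V →L[ℝ] ℝ) := by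
    rw [← (LinearMap.toContinuousLinearMap (𝕜 := ℝ) (E := V) (F' := ℝ)).finrank_eq]
    exact (Subspace.dual_finrank_eq (K := ℝ) (V := V)).symm
  exact ⟨(B.toLinearMap.linearEquivOfInjective hinj hrank).toContinuousLinearEquiv, by ext; rfl⟩

lemma apply_sharp {B : V →L[ℝ] V →L[ℝ] ℝ} (hB : ∀ v, B v = 0 → v = 0) (α : V →L[ℝ] ℝ) :
    B (sharp B α) = α :=
  (isInvertible_of_forall_eq_zero hB).self_apply_inverse α

lemma sharp_apply {B : V →L[ℝ] V →L[ℝ] ℝ} (hB : ∀ v, B v = 0 → v = 0) (v : V) :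
    sharp B (B v) = v :=
  (isInvertible_of_forall_eq_zero hB).inverse_apply_self v

/-- The trace of an inner product with respect to itself is the dimension. -/
lemma metricTrace_self {B : V →L[ℝ] V →L[ℝ] ℝ} (hB : ∀ v, B v = 0 → v = 0)
    (hs : ∀ u v, B u v = B v u) :
    metricTrace B (fun u v ↦ B u v) = Module.finrank ℝ V := by
  simp only [metricTrace]
  have : ∀ a, B (Module.finBasis ℝ V a)
      (sharp B (LinearMap.toContinuousLinearMap ((Module.finBasis ℝ V).coord a))) = 1 := by
    intro a
    rw [hs, apply_sharp hB]
    simp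
  simp [this]

lemma map_metricTrace {W W' : Type*} [AddCommGroup W] [AddCommGroup W'] (ℓ : W →+ W')
    (B : V →L[ℝ] V →L[ℝ] ℝ) (Q : V → V → W) :
    ℓ (metricTrace B Q) = metricTrace B fun u v ↦ ℓ (Q u v) := by
  simp [metricTrace]

lemma metricTrace_add {W : Type*} [AddCommGroup W] (B : V →L[ℝ] V →L[ℝ] ℝ) (Q Q' : V → V → W) :
    metricTrace B (fun u v ↦ Q u v + Q' u v) = metricTrace B Q + metricTrace B Q' := by
  simp [metricTrace, Finset.sum_add_distrib]

lemma metricTrace_const_mul (B : V →L[ℝ] V →L[ℝ] ℝ) (a : ℝ) (Q : V → V → ℝ) :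
    metricTrace B (fun u v ↦ a * Q u v) = a * metricTrace B Q := by
  simp [metricTrace, Finset.mul_sum]

end LinearAlgebra

/-! ### Christoffel symbols and pulled back metrics -/

section Christoffel

variable {E F : Type*} [NormedAddCommGroup E] [NormedSpace ℝ E] [FiniteDimensional ℝ E]
  [NormedAddCommGroup F] [NormedSpace ℝ F] [FiniteDimensional ℝ F]

omit [FiniteDimensional ℝ F] in
lemma differentiableAt_of_clm_apply {G : Type*} [NormedAddCommGroup G] [NormedSpace ℝ G]
    {f : F → E →L[ℝ] G} {y : F} (h : ∀ u, DifferentiableAt ℝ (fun z ↦ f z u) y) :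
    DifferentiableAt ℝ f y := by
  let e₁ : E ≃L[ℝ] (Fin (Module.finrank ℝ E) → ℝ) := ContinuousLinearEquiv.ofFinrankEq (by simp)
  let e₂ := (e₁.arrowCongr (1 : G ≃L[ℝ] G)).trans (ContinuousLinearEquiv.piRing _)
  rw [← Function.id_comp f, ← e₂.symm_comp_self]
  exact e₂.symm.differentiableAt.comp y (differentiableAt_pi.2 fun i ↦ h _)

omit [FiniteDimensional ℝ F] in
lemma differentiableAt_of_clm_apply_apply {γ : F → E →L[ℝ] E →L[ℝ] ℝ} {y : F}
    (h : ∀ u v, DifferentiableAt ℝ (fun z ↦ γ z u v) y) : DifferentiableAt ℝ γ y :=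
  differentiableAt_of_clm_apply fun u ↦ differentiableAt_of_clm_apply (h u)

/-- The Koszul formula. -/
lemma apply_christoffel {γ : F → F →L[ℝ] F →L[ℝ] ℝ} {y : F} (hγ : ∀ v, γ y v = 0 → v = 0)
    (u v w : F) :
    γ y (christoffel γ y u v) w
      = 1 / 2 * (fderiv ℝ γ y u v w + fderiv ℝ γ y v u w - fderiv ℝ γ y w u v) := by
  simp [christoffel, apply_sharp hγ]

omit [FiniteDimensional ℝ E] [FiniteDimensional ℝ F] in
lemma fderiv_apply_apply {γ : F → E →L[ℝ] E →L[ℝ] ℝ} {y : F}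
    (hd : DifferentiableAt ℝ γ y) (u v : E) (w : F) :
    fderiv ℝ γ y w u v = fderiv ℝ (fun z ↦ γ z u v) y w := by
  rw [((hd.hasFDerivAt.clm_apply (hasFDerivAt_const u y)).clm_apply
    (hasFDerivAt_const v y)).fderiv]
  simp

set_option synthInstance.maxHeartbeats 200000 in
/-- **Gauss formula** in coordinates: the Christoffel symbols of the pulled back metric
`f^* γ` are the tangential part of `∂² f + Γ(∂ f, ∂ f)`. -/
lemma apply_christoffel_pullBilin {γ : F → F →L[ℝ] F →L[ℝ] ℝ} {γM : E → E →L[ℝ] E →L[ℝ] ℝ}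
    {f : E → F} {y : E} (hd : DifferentiableAt ℝ γ (f y))
    (hs : ∀ᶠ z in 𝓝 (f y), ∀ u v, γ z u v = γ z v u)
    (hγ : ∀ v, γ (f y) v = 0 → v = 0) (hγM : ∀ v, γM y v = 0 → v = 0)
    (hf : ContDiffAt ℝ 2 f y)
    (h : γM =ᶠ[𝓝 y] fun z ↦ pullBilin (γ (f z)) (fderiv ℝ f z)) (u v w : E) :
    γM y (christoffel γM y u v) w
      = γ (f y) (fderiv ℝ (fderiv ℝ f) y u v
          + christoffel γ (f y) (fderiv ℝ f y u) (fderiv ℝ f y v)) (fderiv ℝ f y w) := by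
  have hf1 : HasFDerivAt f (fderiv ℝ f y) y := (hf.differentiableAt (by norm_num)).hasFDerivAt
  have hf2 : HasFDerivAt (fderiv ℝ f) (fderiv ℝ (fderiv ℝ f) y) y :=
    ((hf.fderiv_right (m := 1) (by norm_num)).differentiableAt (by norm_num)).hasFDerivAt
  have hγf : HasFDerivAt (fun z ↦ γ (f z)) ((fderiv ℝ γ (f y)).comp (fderiv ℝ f y)) y :=
    HasFDerivAt.comp (g := γ) (G := F →L[ℝ] F →L[ℝ] ℝ) y hd.hasFDerivAt hf1
  have hdM : DifferentiableAt ℝ γM y := by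
    refine DifferentiableAt.congr_of_eventuallyEq ?_ h
    refine differentiableAt_of_clm_apply_apply fun u v ↦ ?_
    exact ((hγf.clm_apply (hf2.clm_apply (hasFDerivAt_const u y))).clm_apply
      (hf2.clm_apply (hasFDerivAt_const v y))).differentiableAt
  have key : ∀ u v w, fderiv ℝ γM y w u v
      = fderiv ℝ γ (f y) (fderiv ℝ f y w) (fderiv ℝ f y u) (fderiv ℝ f y v)
        + γ (f y) (fderiv ℝ (fderiv ℝ f) y w u) (fderiv ℝ f y v)
        + γ (f y) (fderiv ℝ f y u) (fderiv ℝ (fderiv ℝ f) y w v) := by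
    intro u v w
    rw [fderiv_apply_apply hdM]
    have h' : (fun z ↦ γM z u v) =ᶠ[𝓝 y]
        fun z ↦ γ (f z) (fderiv ℝ f z u) (fderiv ℝ f z v) := by
      filter_upwards [h] with z hz
      rw [hz]; rfl
    rw [h'.fderiv_eq]
    have h1 := (hγf.clm_apply (hf2.clm_apply (hasFDerivAt_const u y))).clm_apply
      (hf2.clm_apply (hasFDerivAt_const v y))
    have h1' : HasFDerivAt (fun z ↦ γ (f z) (fderiv ℝ f z u) (fderiv ℝ f z v)) _ y := h1
    rw [h1'.fderiv]
    simp
    ring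
  have hsymm : IsSymmSndFDerivAt ℝ f y := hf.isSymmSndFDerivAt (by simp)
  have hsy := hs.self_of_nhds
  have hsd : ∀ a b e, fderiv ℝ γ (f y) e a b = fderiv ℝ γ (f y) e b a := by
    intro a b e
    rw [fderiv_apply_apply hd, fderiv_apply_apply hd]
    have : (fun z ↦ γ z a b) =ᶠ[𝓝 (f y)] fun z ↦ γ z b a := by
      filter_upwards [hs] with z hz using hz a b
    rw [this.fderiv_eq]
  -- Polarize: `∂_u γM(v, w) + ∂_v γM(u, w) - ∂_w γM(u, v)`, where the symmetry of `∂² f` cancels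
  -- all second derivatives but `∂² f(u, v)`.
  rw [apply_christoffel hγM, key, key, key, map_add, _root_.add_apply,
    apply_christoffel hγ, hsymm.eq u w, hsymm.eq v w, hsymm.eq v u]
  rw [hsy (fderiv ℝ f y v) (fderiv ℝ (fderiv ℝ f) y w u)]
  ring

end Christoffel

/-! ### Coordinate expressions on manifolds -/

section Charts

variable {E : Type*} [NormedAddCommGroup E] [NormedSpace ℝ E]
  {H : Type*} [TopologicalSpace H] {I : ModelWithCorners ℝ E H}
  {M : Type*} [TopologicalSpace M] [ChartedSpace H M]
  {F : Type*} [NormedAddCommGroup F] [NormedSpace ℝ F]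
  {G : Type*} [TopologicalSpace G] {J : ModelWithCorners ℝ F G}
  {N : Type*} [TopologicalSpace N] [ChartedSpace G N]

lemma mdifferentiableAt_extChartAt_symm [J.Boundaryless] [IsManifold J ∞ N] {p : N} {y : F}
    (hy : y ∈ (extChartAt J p).target) :
    MDifferentiableAt 𝓘(ℝ, F) J (extChartAt J p).symm y := by
  have : IsManifold J 1 N := .of_le (n := ∞) (by simp)
  have := mdifferentiableWithinAt_extChartAt_symm (I := J) hy
  rwa [J.range_eq_univ, mdifferentiableWithinAt_univ] at this

lemma mfderiv_extChartAt_symm_self [J.Boundaryless] [IsManifold J ∞ N] (p : N) :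
    mfderiv 𝓘(ℝ, F) J (extChartAt J p).symm (extChartAt J p p) = ContinuousLinearMap.id ℝ F := by
  have : IsManifold J 1 N := .of_le (n := ∞) (by simp)
  have := mfderivWithin_range_extChartAt_symm (I := J) (x := p)
  rwa [J.range_eq_univ, mfderivWithin_univ] at this

/-- At `p` itself the coordinate vectors of the preferred chart are the identity frame. -/
lemma chartMetric_self [J.Boundaryless] [IsManifold J ∞ N] (g : MetricTensor J N) (p : N)
    (u v : F) :
    chartMetric J g p (extChartAt J p p) u v = g p u v := by
  have key : ∀ (q : N) (A : F →L[ℝ] F), q = p → A = ContinuousLinearMap.id ℝ F →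
      @pullBilin F (TangentSpace J q) _ _ _ _ _ _ _ _ _ _ (g q) A u v = g p u v := by
    rintro q A rfl rfl
    rfl
  exact key _ _ (extChartAt_to_inv p) (mfderiv_extChartAt_symm_self p)

/-- Stated for the scalar values, since `mfderiv J f y` and `mfderiv J f' y` have different types. -/
lemma apply_mfderiv_congr (g : MetricTensor J N) {f f' : E → N} {y : E}
    (h : f =ᶠ[𝓝 y] f') (u v : E) :
    g (f y) (mfderiv 𝓘(ℝ, E) J f y u) (mfderiv 𝓘(ℝ, E) J f y v)
      = g (f' y) (mfderiv 𝓘(ℝ, E) J f' y u) (mfderiv 𝓘(ℝ, E) J f' y v) := by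
  have key : ∀ (q q' : N) (A A' : E →L[ℝ] F), q = q' → A = A' →
      g q (A u) (A v) = g q' (A' u) (A' v) := by
    rintro q _ A _ rfl rfl
    rfl
  exact key _ _ _ _ h.self_of_nhds h.mfderiv_eq

lemma extChartAt_symm_writtenInExtChartAt {ψ : M → N} (hψ : Continuous ψ) (x : M) :
    (extChartAt J (ψ x)).symm ∘ writtenInExtChartAt I J x ψ
      =ᶠ[𝓝 (extChartAt I x x)] ψ ∘ (extChartAt I x).symm := by
  have hc : ContinuousAt (ψ ∘ (extChartAt I x).symm) (extChartAt I x x) :=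
    hψ.continuousAt.comp (continuousAt_extChartAt_symm x)
  have : (ψ ∘ (extChartAt I x).symm) ⁻¹' (extChartAt J (ψ x)).source ∈ 𝓝 (extChartAt I x x) := by
    apply hc
    simpa using extChartAt_source_mem_nhds (I := J) (ψ x)
  filter_upwards [this] with y hy
  exact (extChartAt J (ψ x)).left_inv hy

lemma contDiffAt_writtenInExtChartAt [I.Boundaryless] {ψ : M → N} (hψ : ContMDiff I J ∞ ψ) (x : M) :
    ContDiffAt ℝ ∞ (writtenInExtChartAt I J x ψ) (extChartAt I x x) := by
  have := (contMDiffAt_iff.1 (hψ x)).2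
  rwa [I.range_eq_univ, contDiffWithinAt_univ] at this

lemma mfderiv_eq_fderiv_writtenInExtChartAt [I.Boundaryless] {ψ : M → N}
    (hψ : ContMDiff I J ∞ ψ) (x : M) :
    mfderiv I J ψ x = fderiv ℝ (writtenInExtChartAt I J x ψ) (extChartAt I x x) := by
  have h : MDifferentiableAt I J ψ x := (hψ x).mdifferentiableAt (by simp)
  rw [h.mfderiv, I.range_eq_univ, fderivWithin_univ]

/-- In coordinates an isometric immersion pulls the metric back. -/
lemma IsIsometricImmersion.chartMetric_eventuallyEq [I.Boundaryless] [IsManifold I ∞ M]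
    [J.Boundaryless] [IsManifold J ∞ N] {gM : MetricTensor I M} {g : MetricTensor J N}
    {ψ : M → N} (hψ : IsIsometricImmersion I J gM g ψ) (x : M) :
    chartMetric I gM x =ᶠ[𝓝 (extChartAt I x x)] fun y ↦
      pullBilin (chartMetric J g (ψ x) (writtenInExtChartAt I J x ψ y))
        (fderiv ℝ (writtenInExtChartAt I J x ψ) y) := by
  have hC := contDiffAt_writtenInExtChartAt (J := J) hψ.1 x
  have hd : ∀ᶠ y in 𝓝 (extChartAt I x x),
      DifferentiableAt ℝ (writtenInExtChartAt I J x ψ) y :=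
    ((hC.of_le (m := 1) (by simp)).eventually (by simp)).mono
      fun y hy ↦ hy.differentiableAt (by norm_num)
  have htgt : ∀ᶠ y in 𝓝 (extChartAt I x x),
      writtenInExtChartAt I J x ψ y ∈ (extChartAt J (ψ x)).target := by
    apply hC.continuousAt
    simpa [writtenInExtChartAt] using extChartAt_target_mem_nhds (I := J) (ψ x)
  filter_upwards [(extChartAt_symm_writtenInExtChartAt (I := I) (J := J)
    hψ.1.continuous x).eventuallyEq_nhds, hd, htgt,
    extChartAt_target_mem_nhds (I := I) x] with y hy hdy hty hyI
  ext u v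
  have h1 : chartMetric I gM x y u v = g ((ψ ∘ (extChartAt I x).symm) y)
      (mfderiv 𝓘(ℝ, E) J (ψ ∘ (extChartAt I x).symm) y u)
      (mfderiv 𝓘(ℝ, E) J (ψ ∘ (extChartAt I x).symm) y v) := by
    rw [mfderiv_comp y ((hψ.1 _).mdifferentiableAt (by simp))
      (mdifferentiableAt_extChartAt_symm hyI)]
    exact (hψ.2 _ _ _).symm
  rw [h1, ← apply_mfderiv_congr g hy,
    mfderiv_comp y (mdifferentiableAt_extChartAt_symm hty) hdy.mdifferentiableAt, mfderiv_eq_fderiv]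
  rfl

end Charts

/-! ### Christoffel symbols of a warped metric -/

section WarpedCoordinates

variable {V : Type*} [NormedAddCommGroup V] [NormedSpace ℝ V]
  {γ : ℝ × V → (ℝ × V) →L[ℝ] (ℝ × V) →L[ℝ] ℝ} {γ₀ : V → V →L[ℝ] V →L[ℝ] ℝ} {h : ℝ → ℝ} {h' : ℝ}
  {y : ℝ × V}

section Derivative

set_option synthInstance.maxHeartbeats 200000

variable (hγ : ∀ᶠ z in 𝓝 y, ∀ u v, γ z u v = u.1 * v.1 + h z.1 ^ 2 * γ₀ z.2 u.2 v.2)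
  (hh : HasDerivAt h h' y.1) (hγ₀ : DifferentiableAt ℝ γ₀ y.2)
include hγ hh hγ₀

lemma hasFDerivAt_warped_apply (u v : ℝ × V) :
    HasFDerivAt (fun z ↦ γ z u v)
      ((2 * h y.1 * h' * γ₀ y.2 u.2 v.2) • ContinuousLinearMap.fst ℝ ℝ V
        + (h y.1 ^ 2) • (fderiv ℝ (fun z ↦ γ₀ z u.2 v.2) y.2).comp
            (ContinuousLinearMap.snd ℝ ℝ V)) y := by
  have h1 : HasFDerivAt (fun z : ℝ × V ↦ h z.1) (h' • ContinuousLinearMap.fst ℝ ℝ V) y :=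
    hh.comp_hasFDerivAt y hasFDerivAt_fst
  have h2 : DifferentiableAt ℝ (fun z ↦ γ₀ z u.2 v.2) y.2 :=
    (hγ₀.clm_apply (differentiableAt_const u.2)).clm_apply (differentiableAt_const v.2)
  have h3 : HasFDerivAt (fun z : ℝ × V ↦ γ₀ z.2 u.2 v.2)
      ((fderiv ℝ (fun z ↦ γ₀ z u.2 v.2) y.2).comp (ContinuousLinearMap.snd ℝ ℝ V)) y :=
    h2.hasFDerivAt.comp y hasFDerivAt_snd
  have h4 := ((h1.pow 2).mul h3).const_add (u.1 * v.1)
  have h5 : (fun z ↦ γ z u v) =ᶠ[𝓝 y]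
      fun z ↦ u.1 * v.1 + (h z.1 ^ 2) * γ₀ z.2 u.2 v.2 := by
    filter_upwards [hγ] with z hz using hz u v
  refine (h4.congr_of_eventuallyEq h5).congr_fderiv ?_
  ext <;> simp
  ring

variable [FiniteDimensional ℝ V]

lemma differentiableAt_warped : DifferentiableAt ℝ γ y :=
  differentiableAt_of_clm_apply_apply fun u v ↦
    (hasFDerivAt_warped_apply hγ hh hγ₀ u v).differentiableAt

lemma fderiv_warped (u v w : ℝ × V) :
    fderiv ℝ γ y w u v
      = 2 * h y.1 * h' * w.1 * γ₀ y.2 u.2 v.2 + h y.1 ^ 2 * fderiv ℝ γ₀ y.2 w.2 u.2 v.2 := by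
  rw [fderiv_apply_apply (differentiableAt_warped hγ hh hγ₀),
    (hasFDerivAt_warped_apply hγ hh hγ₀ u v).fderiv,
    fderiv_apply_apply hγ₀]
  simp
  ring

variable (hnd : ∀ v, γ y v = 0 → v = 0)
include hnd

/-- `Γᵗ(u, v) = -h h' γ₀(u, v)`: the Koszul formula tested against `∂_t`, where only the
`t`-derivative of the metric contributes. -/
lemma christoffel_warped_fst (u v : ℝ × V) :
    (christoffel γ y u v).1 = - (h y.1 * h' * γ₀ y.2 u.2 v.2) := by
  have h1 := apply_christoffel hnd u v (1, 0)
  rw [hγ.self_of_nhds, fderiv_warped hγ hh hγ₀, fderiv_warped hγ hh hγ₀,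
    fderiv_warped hγ hh hγ₀] at h1
  simp at h1
  linarith

/-- `Γ(u, a ∂_t) = a (h' / h) u_P`, with `u_P` the component of `u` along the fibre. -/
lemma christoffel_warped_vertical (u : ℝ × V) (a : ℝ) :
    christoffel γ y u (a, 0) = (0, (a * h' / h y.1) • u.2) := by
  rw [← sub_eq_zero]
  apply hnd
  refine ContinuousLinearMap.ext fun w ↦ ?_
  rw [map_sub, _root_.sub_apply, apply_christoffel hnd, fderiv_warped hγ hh hγ₀,
    fderiv_warped hγ hh hγ₀, fderiv_warped hγ hh hγ₀, hγ.self_of_nhds]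
  simp
  -- What remains is `h h' a γ₀ = h² (a h' / h) γ₀`, which also holds where `h` vanishes.
  field_simp
  ring

end Derivative

end WarpedCoordinates

/-! ### Charts of the warped product -/

section WarpedManifold

variable {n : ℕ} {P : Type*} [TopologicalSpace P] [ChartedSpace (EuclideanSpace ℝ (Fin n)) P]
  [IsManifold 𝓘(ℝ, EuclideanSpace ℝ (Fin n)) ∞ P] {T : Opens ℝ}

omit [IsManifold 𝓘(ℝ, EuclideanSpace ℝ (Fin n)) ∞ P] in
lemma coe_fst_extChartAt_symm {q : T × P} {y : ℝ × EuclideanSpace ℝ (Fin n)}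
    (hy : y ∈ (extChartAt (warpedModel n) q).target) :
    (((extChartAt (warpedModel n) q).symm y).1 : ℝ) = y.1 :=
  congrArg Prod.fst ((extChartAt (warpedModel n) q).right_inv hy)

/-- The charts of `T × P` are products, and the chart of `T` is the inclusion `T → ℝ`. -/
lemma mfderiv_extChartAt_symm_fst {q : T × P} {y : ℝ × EuclideanSpace ℝ (Fin n)}
    (hy : y ∈ (extChartAt (warpedModel n) q).target) (u : ℝ × EuclideanSpace ℝ (Fin n)) :
    (mfderiv 𝓘(ℝ, ℝ × EuclideanSpace ℝ (Fin n)) (warpedModel n)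
      (extChartAt (warpedModel n) q).symm y u).1 = u.1 := by
  set e := (extChartAt (warpedModel n) q).symm
  have h0 : (fun z ↦ ((e z).1 : ℝ)) =ᶠ[𝓝 y] Prod.fst := by
    filter_upwards [extChartAt_target_mem_nhds' (I := warpedModel n) hy] with z hz
    exact coe_fst_extChartAt_symm hz
  -- The preferred chart of `T` at any point is the inclusion, whose differential is the identity.
  have hval : HasMFDerivAt 𝓘(ℝ, ℝ) 𝓘(ℝ, ℝ) (Subtype.val : T → ℝ) (e y).1
      (ContinuousLinearMap.id ℝ ℝ) := by
    have h1 : mfderiv 𝓘(ℝ, ℝ) 𝓘(ℝ, ℝ) (Subtype.val : T → ℝ) (e y).1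
        = ContinuousLinearMap.id ℝ ℝ := mfderiv_extChartAt_self (I := 𝓘(ℝ, ℝ)) (x := (e y).1)
    have h2 : MDifferentiableAt 𝓘(ℝ, ℝ) 𝓘(ℝ, ℝ) (Subtype.val : T → ℝ) (e y).1 :=
      (contMDiff_subtype_val (n := 1) _).mdifferentiableAt (by simp)
    rw [← h1]
    exact h2.hasMFDerivAt
  have h3 := (hval.comp (e y) (hasMFDerivAt_fst (e y))).comp y
    (mdifferentiableAt_extChartAt_symm (J := warpedModel n) hy).hasMFDerivAt
  have h4 := h3.mfderiv
  have h5 : mfderiv 𝓘(ℝ, ℝ × EuclideanSpace ℝ (Fin n)) 𝓘(ℝ, ℝ)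
      (fun z ↦ ((e z).1 : ℝ)) y u = u.1 := by
    rw [h0.mfderiv_eq, mfderiv_eq_fderiv, fderiv_fst]
    rfl
  rw [← h5]
  exact (DFunLike.congr_fun h4 u).symm

lemma mfderiv_extChartAt_symm_snd {q : T × P} {y : ℝ × EuclideanSpace ℝ (Fin n)}
    (hy : y ∈ (extChartAt (warpedModel n) q).target) (u : ℝ × EuclideanSpace ℝ (Fin n)) :
    (mfderiv 𝓘(ℝ, ℝ × EuclideanSpace ℝ (Fin n)) (warpedModel n)
      (extChartAt (warpedModel n) q).symm y u).2
      = mfderiv 𝓘(ℝ, EuclideanSpace ℝ (Fin n)) 𝓘(ℝ, EuclideanSpace ℝ (Fin n))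
          (extChartAt 𝓘(ℝ, EuclideanSpace ℝ (Fin n)) q.2).symm y.2 u.2 := by
  have hy2 : y.2 ∈ (extChartAt 𝓘(ℝ, EuclideanSpace ℝ (Fin n)) q.2).target := by
    rw [extChartAt_prod] at hy
    exact hy.2
  have h1 := (hasMFDerivAt_snd ((extChartAt (warpedModel n) q).symm y)).comp y
    (mdifferentiableAt_extChartAt_symm (J := warpedModel n) hy).hasMFDerivAt
  have h2 := (mdifferentiableAt_extChartAt_symm
    (J := 𝓘(ℝ, EuclideanSpace ℝ (Fin n))) hy2).hasMFDerivAt.comp y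
    (hasFDerivAt_snd (𝕜 := ℝ) (p := y)).hasMFDerivAt
  exact DFunLike.congr_fun (h1.mfderiv.symm.trans h2.mfderiv) u

/-- In coordinates the warped metric is `dt² + h(t)² γ₀`, with `γ₀` the coordinate expression of
the metric of the fibre. -/
lemma chartMetric_warpedMetric (h : ℝ → ℝ)
    (g₀ : MetricTensor 𝓘(ℝ, EuclideanSpace ℝ (Fin n)) P) {q : T × P}
    {y : ℝ × EuclideanSpace ℝ (Fin n)} (hy : y ∈ (extChartAt (warpedModel n) q).target)
    (u v : ℝ × EuclideanSpace ℝ (Fin n)) :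
    chartMetric (warpedModel n) (warpedMetric T h g₀) q y u v
      = u.1 * v.1 + h y.1 ^ 2 * chartMetric 𝓘(ℝ, EuclideanSpace ℝ (Fin n)) g₀ q.2 y.2 u.2 v.2 := by
  rw [← mfderiv_extChartAt_symm_fst hy u, ← mfderiv_extChartAt_symm_fst hy v,
    ← coe_fst_extChartAt_symm hy]
  change _ + h _ ^ 2 * g₀ _ _ _ = _ + h _ ^ 2 * g₀ _ _ _
  congr 2
  exact congrArg₂ (fun a b ↦ g₀ ((extChartAt (warpedModel n) q).symm y).2 a b)
    (mfderiv_extChartAt_symm_snd hy u) (mfderiv_extChartAt_symm_snd hy v)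

end WarpedManifold

/-! ### Regularity of the components of a metric -/

section SmoothMetric

variable {F : Type*} [NormedAddCommGroup F] [NormedSpace ℝ F] [FiniteDimensional ℝ F]
  {G : Type*} [TopologicalSpace G] {J : ModelWithCorners ℝ F G} [J.Boundaryless]
  {N : Type*} [TopologicalSpace N] [ChartedSpace G N] [IsManifold J ∞ N]

/-- The components of a smooth metric are differentiable. -/
lemma differentiableAt_chartMetric
    (g : Bundle.ContMDiffRiemannianMetric J ∞ F (fun p : N ↦ TangentSpace J p)) {p : N} {y : F}
    (hy : y ∈ (extChartAt J p).target) :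
    DifferentiableAt ℝ (chartMetric J g.inner p) y := by
  refine differentiableAt_of_clm_apply_apply fun u v ↦ ?_
  have hsymm : ContMDiffOn 𝓘(ℝ, F) J 2 (extChartAt J p).symm (extChartAt J p).target :=
    (contMDiffOn_extChartAt_symm (n := ∞) p).of_le (WithTop.coe_le_coe.2 (le_top : (2 : ℕ∞) ≤ ⊤))
  have hopen : IsOpen (extChartAt J p).target := isOpen_extChartAt_target p
  have : IsManifold J 1 N := .of_le (n := ∞) (by simp)
  have htan := hsymm.contMDiffOn_tangentMapWithin (m := 1) (by norm_num) hopen.uniqueMDiffOn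
  have hsec : ∀ u : F, MDifferentiableAt 𝓘(ℝ, F) (J.prod 𝓘(ℝ, F))
      (fun z ↦ Bundle.TotalSpace.mk' F (E := fun p : N ↦ TangentSpace J p)
        ((extChartAt J p).symm z) (mfderiv 𝓘(ℝ, F) J (extChartAt J p).symm z u)) y := by
    intro u
    have h1 : MDifferentiableAt 𝓘(ℝ, F) (𝓘(ℝ, F).prod 𝓘(ℝ, F))
        (fun z : F ↦ (⟨z, u⟩ : TangentBundle 𝓘(ℝ, F) F)) y :=
      ((contMDiffAt_vectorSpace_iff_contDiffAt (n := 1)).2 contDiffAt_const).mdifferentiableAt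
        (by simp)
    have h2 := (htan.contMDiffAt (x := (⟨y, u⟩ : TangentBundle 𝓘(ℝ, F) F))
      ((FiberBundle.continuous_proj F (TangentSpace 𝓘(ℝ, F))).continuousAt.preimage_mem_nhds
        (hopen.mem_nhds hy))).mdifferentiableAt (by simp)
    refine (h2.comp y h1).congr_of_eventuallyEq ?_
    filter_upwards [hopen.mem_nhds hy] with z hz
    rw [← mfderivWithin_of_isOpen hopen hz]
    rfl
  have hg : MDifferentiableAt 𝓘(ℝ, F) (J.prod 𝓘(ℝ, F →L[ℝ] F →L[ℝ] ℝ))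
      (fun z ↦ Bundle.TotalSpace.mk' (F →L[ℝ] F →L[ℝ] ℝ)
        (E := fun p : N ↦ (TangentSpace J p →L[ℝ] TangentSpace J p →L[ℝ] ℝ))
        ((extChartAt J p).symm z) (g.inner ((extChartAt J p).symm z))) y :=
    ((g.contMDiff _).mdifferentiableAt (by simp)).comp y (mdifferentiableAt_extChartAt_symm hy)
  have h3 := MDifferentiableAt.clm_bundle_apply₂ (F₃ := ℝ) (E₃ := fun _ : N ↦ ℝ) hg
    (hsec u) (hsec v)
  have h4 := (mdifferentiableAt_totalSpace _ _).1 h3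
  exact h4.2.differentiableAt

end SmoothMetric

/-! ### The Gauss formula for isometric immersions -/

section Submanifold

variable {E : Type*} [NormedAddCommGroup E] [NormedSpace ℝ E] [FiniteDimensional ℝ E]
  {H : Type*} [TopologicalSpace H] {I : ModelWithCorners ℝ E H}
  {M : Type*} [TopologicalSpace M] [ChartedSpace H M]
  {F : Type*} [NormedAddCommGroup F] [NormedSpace ℝ F] [FiniteDimensional ℝ F]
  {G : Type*} [TopologicalSpace G] {J : ModelWithCorners ℝ F G}
  {N : Type*} [TopologicalSpace N] [ChartedSpace G N]
  {gM : MetricTensor I M} {g : MetricTensor J N} {ψ : M → N}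

omit [FiniteDimensional ℝ E] [FiniteDimensional ℝ F] in
lemma IsIsometricImmersion.inducedMetric_eq (hψ : IsIsometricImmersion I J gM g ψ) (x : M) :
    inducedMetric I J g ψ x = gM x := by
  refine ContinuousLinearMap.ext fun u ↦ ContinuousLinearMap.ext fun v ↦ ?_
  exact hψ.2 x u v

omit [FiniteDimensional ℝ F] in
lemma IsIsometricImmersion.tangentialPart_eq (hψ : IsIsometricImmersion I J gM g ψ) {x : M}
    (hgM : ∀ v, gM x v = 0 → v = 0) {w : TangentSpace J (ψ x)} {a : TangentSpace I x}
    (h : ∀ v, gM x a v = g (ψ x) w (mfderiv I J ψ x v)) :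
    tangentialPart I J g ψ x w = mfderiv I J ψ x a := by
  have h1 : (g (ψ x) w).comp (mfderiv I J ψ x) = gM x a :=
    ContinuousLinearMap.ext fun v ↦ (h v).symm
  rw [tangentialPart, h1, hψ.inducedMetric_eq]
  exact congrArg _ (sharp_apply (V := E) hgM a)

/-- Gauss formula: the tangential part of `∇_{dψ U} (dψ V)` is `dψ (∇_U V)`. -/
lemma IsIsometricImmersion.tangentialPart_covDerivPush [I.Boundaryless] [IsManifold I ∞ M]
    [J.Boundaryless] [IsManifold J ∞ N] (hψ : IsIsometricImmersion I J gM g ψ) {x : M}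
    (hgM : ∀ v, gM x v = 0 → v = 0) (hg : ∀ v, g (ψ x) v = 0 → v = 0)
    (hd : DifferentiableAt ℝ (chartMetric J g (ψ x)) (extChartAt J (ψ x) (ψ x)))
    (hs : ∀ᶠ z in 𝓝 (extChartAt J (ψ x) (ψ x)), ∀ u v,
      chartMetric J g (ψ x) z u v = chartMetric J g (ψ x) z v u) (u v : TangentSpace I x) :
    tangentialPart I J g ψ x (covDerivPush I J g ψ x u v)
      = mfderiv I J ψ x (christoffel (F := E) (chartMetric I gM x) (extChartAt I x x) u v) := by
  refine hψ.tangentialPart_eq hgM fun w ↦ ?_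
  have hf : writtenInExtChartAt I J x ψ (extChartAt I x x) = extChartAt J (ψ x) (ψ x) := by
    simp [writtenInExtChartAt]
  have hγM : ∀ v : E, chartMetric I gM x (extChartAt I x x) v = 0 → v = 0 := fun v hv ↦
    hgM v (ContinuousLinearMap.ext fun w ↦ by
      rw [← chartMetric_self gM x v w, hv]; rfl)
  have hγ : ∀ v : F, chartMetric J g (ψ x) (extChartAt J (ψ x) (ψ x)) v = 0 → v = 0 := fun v hv ↦
    hg v (ContinuousLinearMap.ext fun w ↦ by
      rw [← chartMetric_self g (ψ x) v w, hv]; rfl)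
  have key := apply_christoffel_pullBilin (E := E) (F := F) (γ := chartMetric J g (ψ x))
    (γM := chartMetric I gM x) (f := writtenInExtChartAt I J x ψ) (y := extChartAt I x x)
    (by rwa [hf]) (by rwa [hf]) (by rwa [hf]) hγM
    ((contDiffAt_writtenInExtChartAt hψ.1 x).of_le (WithTop.coe_le_coe.2 (le_top : (2 : ℕ∞) ≤ ⊤)))
    (hψ.chartMetric_eventuallyEq x) u v w
  rw [hf, chartMetric_self g, ← mfderiv_eq_fderiv_writtenInExtChartAt hψ.1 x] at key
  exact (chartMetric_self gM x _ _).symm.trans key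

end Submanifold

/-! ### The conformal field of a warped product -/

section WarpedGeometry

variable {n : ℕ} {P : Type*} [TopologicalSpace P] [ChartedSpace (EuclideanSpace ℝ (Fin n)) P]
  [IsManifold 𝓘(ℝ, EuclideanSpace ℝ (Fin n)) ∞ P]
  (g₀ : Bundle.ContMDiffRiemannianMetric 𝓘(ℝ, EuclideanSpace ℝ (Fin n)) ∞
    (EuclideanSpace ℝ (Fin n)) (fun p : P ↦ TangentSpace 𝓘(ℝ, EuclideanSpace ℝ (Fin n)) p))
  {T : Opens ℝ} {h : ℝ → ℝ}

omit [IsManifold 𝓘(ℝ, EuclideanSpace ℝ (Fin n)) ∞ P] in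
lemma warpedMetric_apply (g₀ : MetricTensor 𝓘(ℝ, EuclideanSpace ℝ (Fin n)) P) (q : T × P)
    (u v : TangentSpace (warpedModel n) q) :
    warpedMetric T h g₀ q u v = u.1 * v.1 + h q.1 ^ 2 * g₀ q.2 u.2 v.2 := rfl

omit [IsManifold 𝓘(ℝ, EuclideanSpace ℝ (Fin n)) ∞ P] in
lemma warpedMetric_warpedField (g₀ : MetricTensor 𝓘(ℝ, EuclideanSpace ℝ (Fin n)) P) (q : T × P)
    (u : TangentSpace (warpedModel n) q) :
    warpedMetric T h g₀ q u (warpedField T h q) = h q.1 * u.1 := by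
  have h1 : g₀ q.2 u.2 (0 : EuclideanSpace ℝ (Fin n)) = 0 := map_zero _
  rw [warpedMetric_apply, warpedField]
  change u.1 * h q.1 + h q.1 ^ 2 * g₀ q.2 u.2 (0 : EuclideanSpace ℝ (Fin n)) = h q.1 * u.1
  rw [h1]
  ring

lemma warpedMetric_symm (q : T × P) (u v : TangentSpace (warpedModel n) q) :
    warpedMetric T h g₀.inner q u v = warpedMetric T h g₀.inner q v u := by
  have h1 := g₀.symm q.2 u.2 v.2
  rw [warpedMetric_apply, warpedMetric_apply, h1, mul_comm u.1]

lemma eq_zero_of_warpedMetric_eq_zero {q : T × P} (hq : h q.1 ≠ 0)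
    {v : TangentSpace (warpedModel n) q} (hv : warpedMetric T h g₀.inner q v = 0) : v = 0 := by
  have h0 : v.1 * v.1 + h q.1 ^ 2 * g₀.inner q.2 v.2 v.2 = 0 := by
    rw [← warpedMetric_apply, hv]; rfl
  have h2 : v.2 = 0 := by
    by_contra hne
    have := mul_pos (pow_pos (abs_pos.2 hq) 2) (g₀.pos q.2 v.2 hne)
    rw [sq_abs] at this
    nlinarith [mul_self_nonneg v.1]
  have h1 : v.1 = 0 := by
    have h3 : g₀.inner q.2 v.2 v.2 = 0 := by
      rw [h2]
      exact map_zero _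
    rw [h3] at h0
    simpa using h0
  exact Prod.ext h1 h2

lemma eventually_chartMetric_warpedMetric (g₀ : MetricTensor 𝓘(ℝ, EuclideanSpace ℝ (Fin n)) P)
    (q : T × P) :
    ∀ᶠ z in 𝓝 (extChartAt (warpedModel n) q q), ∀ u v,
      chartMetric (warpedModel n) (warpedMetric T h g₀) q z u v
        = u.1 * v.1
          + h z.1 ^ 2 * chartMetric 𝓘(ℝ, EuclideanSpace ℝ (Fin n)) g₀ q.2 z.2 u.2 v.2 := by
  filter_upwards [extChartAt_target_mem_nhds (I := warpedModel n) q] with z hz u v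
  exact chartMetric_warpedMetric h g₀ hz u v

lemma chartMetric_warpedMetric_nondegenerate {q : T × P} (hq : h q.1 ≠ 0)
    (v : ℝ × EuclideanSpace ℝ (Fin n))
    (hv : chartMetric (warpedModel n) (warpedMetric T h g₀.inner) q
      (extChartAt (warpedModel n) q q) v = 0) : v = 0 :=
  eq_zero_of_warpedMetric_eq_zero g₀ hq (ContinuousLinearMap.ext fun w ↦ by
    rw [← chartMetric_self (warpedMetric T h g₀.inner) q v w, hv]; rfl)

lemma differentiableAt_chartMetric_fibre (q : T × P) :
    DifferentiableAt ℝ (chartMetric 𝓘(ℝ, EuclideanSpace ℝ (Fin n)) g₀.inner q.2)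
      (extChartAt (warpedModel n) q q).2 :=
  differentiableAt_chartMetric g₀ (mem_extChartAt_target q.2)

/-- The field `X = h ∂_t` is closed and conformal: `∇_u X = h' u`. -/
lemma covDeriv_warpedField {q : T × P} (hh : DifferentiableAt ℝ h q.1) (hq : h q.1 ≠ 0)
    (u : TangentSpace (warpedModel n) q) :
    covDeriv (warpedModel n) (warpedMetric T h g₀.inner) (warpedField T h) q u
      = deriv h q.1 • u := by
  have h1 : (fun y : ℝ × EuclideanSpace ℝ (Fin n) ↦
      mfderiv (warpedModel n) 𝓘(ℝ, ℝ × EuclideanSpace ℝ (Fin n)) (extChartAt (warpedModel n) q)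
        ((extChartAt (warpedModel n) q).symm y)
        (warpedField T h ((extChartAt (warpedModel n) q).symm y)))
      =ᶠ[𝓝 (extChartAt (warpedModel n) q q)] fun y ↦ (h y.1, 0) := by
    filter_upwards [extChartAt_target_mem_nhds (I := warpedModel n) q] with y hy
    have h2 : warpedField T h ((extChartAt (warpedModel n) q).symm y)
        = mfderiv 𝓘(ℝ, ℝ × EuclideanSpace ℝ (Fin n)) (warpedModel n)
            (extChartAt (warpedModel n) q).symm y (h y.1, 0) := by
      refine Prod.ext ?_ ?_
      · rw [mfderiv_extChartAt_symm_fst hy, ← coe_fst_extChartAt_symm hy]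
        rfl
      · rw [mfderiv_extChartAt_symm_snd hy]
        exact (map_zero _).symm
    have : IsManifold (warpedModel n) 1 (T × P) := .of_le (n := ∞) (by simp)
    have h3 := mfderiv_extChartAt_comp_mfderivWithin_extChartAt_symm (I := warpedModel n) hy
    rw [(warpedModel n).range_eq_univ, mfderivWithin_univ] at h3
    rw [h2]
    exact DFunLike.congr_fun h3 _
  have h4 : HasFDerivAt (fun y : ℝ × EuclideanSpace ℝ (Fin n) ↦
      ((h y.1, 0) : ℝ × EuclideanSpace ℝ (Fin n)))
      ((deriv h q.1 • ContinuousLinearMap.fst ℝ ℝ (EuclideanSpace ℝ (Fin n))).prod 0)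
      (extChartAt (warpedModel n) q q) :=
    HasFDerivAt.prodMk (HasDerivAt.comp_hasFDerivAt (h₂ := h) _ hh.hasDerivAt hasFDerivAt_fst)
      (hasFDerivAt_const _ _)
  have h5 := christoffel_warped_vertical (eventually_chartMetric_warpedMetric (h := h) g₀.inner q)
    hh.hasDerivAt (differentiableAt_chartMetric_fibre g₀ q)
    (chartMetric_warpedMetric_nondegenerate g₀ hq) u (h q.1)
  rw [covDeriv, h1.fderiv_eq, h4.fderiv]
  refine (congrArg (_ + ·) h5).trans ?_
  refine Prod.ext ?_ ?_
  · change deriv h q.1 * u.1 + 0 = deriv h q.1 * u.1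
    simp
  · change 0 + (h q.1 * deriv h q.1 / h q.1) • u.2 = deriv h q.1 • u.2
    rw [zero_add, mul_div_cancel_left₀ _ hq]

lemma divergence_warpedField {q : T × P} (hh : DifferentiableAt ℝ h q.1) (hq : h q.1 ≠ 0) :
    divergence (warpedModel n) (warpedMetric T h g₀.inner) (warpedField T h) q
      = (n + 1) * deriv h q.1 := by
  rw [divergence]
  have : ∀ a, (Module.finBasis ℝ (ℝ × EuclideanSpace ℝ (Fin n))).coord a
      (covDeriv (warpedModel n) (warpedMetric T h g₀.inner) (warpedField T h) q
        (Module.finBasis ℝ (ℝ × EuclideanSpace ℝ (Fin n)) a)) = deriv h q.1 := by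
    intro a
    refine (congrArg ((Module.finBasis ℝ (ℝ × EuclideanSpace ℝ (Fin n))).coord a)
      (covDeriv_warpedField g₀ hh hq
        (Module.finBasis ℝ (ℝ × EuclideanSpace ℝ (Fin n)) a))).trans ?_
    refine (((Module.finBasis ℝ (ℝ × EuclideanSpace ℝ (Fin n))).coord a).map_smul _ _).trans ?_
    simp
  rw [Finset.sum_congr rfl fun a _ ↦ this a]
  simp [add_comm]

end WarpedGeometry

/-! ### The derivatives of the height integral -/

section HeightIntegral

variable {T : Opens ℝ} {h : ℝ → ℝ}

lemma hasDerivAt_integral_of_ordConnected (hT : (T : Set ℝ).OrdConnected)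
    (hh : ContinuousOn h T) (t₀ : T) {s : ℝ} (hs : s ∈ T) :
    HasDerivAt (fun r ↦ ∫ t in (t₀ : ℝ)..r, h t) (h s) s := by
  have hsub : uIcc (t₀ : ℝ) s ⊆ T := hT.uIcc_subset t₀.2 hs
  exact intervalIntegral.integral_hasDerivAt_right (hh.mono hsub).intervalIntegrable
    (hh.stronglyMeasurableAtFilter T.isOpen s hs) (hh.continuousAt (T.isOpen.mem_nhds hs))

variable {n : ℕ} {P : Type*} [TopologicalSpace P] [ChartedSpace (EuclideanSpace ℝ (Fin n)) P]
  {E : Type*} [NormedAddCommGroup E] [NormedSpace ℝ E]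
  {H : Type*} [TopologicalSpace H] {I : ModelWithCorners ℝ E H} [I.Boundaryless]
  {M : Type*} [TopologicalSpace M] [ChartedSpace H M] {ψ : M → T × P}

omit [I.Boundaryless] in
/-- The first derivative of `η` in coordinates. -/
lemma hasFDerivAt_heightIntegral_chart (hT : (T : Set ℝ).OrdConnected)
    (hh : ContinuousOn h T) (t₀ : T) (x : M) {y : E}
    (hf : DifferentiableAt ℝ (writtenInExtChartAt I (warpedModel n) x ψ) y) :
    HasFDerivAt (heightIntegral h t₀ ψ ∘ (extChartAt I x).symm)
      (h (writtenInExtChartAt I (warpedModel n) x ψ y).1 •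
        (ContinuousLinearMap.fst ℝ ℝ (EuclideanSpace ℝ (Fin n))).comp
          (fderiv ℝ (writtenInExtChartAt I (warpedModel n) x ψ) y)) y :=
  HasDerivAt.comp_hasFDerivAt (h₂ := fun r ↦ ∫ t in (t₀ : ℝ)..r, h t)
    (f := fun z ↦ (writtenInExtChartAt I (warpedModel n) x ψ z).1) y
    (hasDerivAt_integral_of_ordConnected hT hh t₀ (ψ ((extChartAt I x).symm y)).1.2)
    (hasFDerivAt_fst.comp y hf.hasFDerivAt)

omit [I.Boundaryless] in
lemma writtenInExtChartAt_fst_self (x : M) :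
    (writtenInExtChartAt I (warpedModel n) x ψ (extChartAt I x x)).1 = (ψ x).1 := by
  have : writtenInExtChartAt I (warpedModel n) x ψ (extChartAt I x x)
      = extChartAt (warpedModel n) (ψ x) (ψ x) := by
    simp [writtenInExtChartAt]
  rw [this]
  rfl

/-- The differential of `η` is `dη(v) = ⟨X, dψ v⟩`, that is `h` times the `∂_t`-component. -/
lemma hasMFDerivAt_heightIntegral (hT : (T : Set ℝ).OrdConnected) (hh : ContinuousOn h T)
    (t₀ : T) (hψ : ContMDiff I (warpedModel n) ∞ ψ) (x : M) :
    HasMFDerivAt I 𝓘(ℝ, ℝ) (heightIntegral h t₀ ψ) x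
      (h (ψ x).1 • (ContinuousLinearMap.fst ℝ ℝ (EuclideanSpace ℝ (Fin n))).comp
        (mfderiv I (warpedModel n) ψ x)) := by
  have hd := (contDiffAt_writtenInExtChartAt hψ x).differentiableAt (by simp)
  refine ⟨?_, ?_⟩
  · have h1 := (hasDerivAt_integral_of_ordConnected hT hh t₀ (ψ x).1.2).continuousAt
    have h2 : ContinuousAt (fun x ↦ ((ψ x).1 : ℝ)) x :=
      (continuous_subtype_val.comp (continuous_fst.comp hψ.continuous)).continuousAt
    exact ContinuousAt.comp (f := fun x ↦ ((ψ x).1 : ℝ)) h1 h2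
  · have h3 := hasFDerivAt_heightIntegral_chart hT hh t₀ x hd
    rw [writtenInExtChartAt_fst_self, ← mfderiv_eq_fderiv_writtenInExtChartAt hψ x] at h3
    exact h3.hasFDerivWithinAt

/-- The second derivative of `η` in coordinates. -/
lemma fderiv_fderiv_heightIntegral (hT : (T : Set ℝ).OrdConnected) (hh : ContDiffOn ℝ ∞ h T)
    (t₀ : T) (hψ : ContMDiff I (warpedModel n) ∞ ψ) (x : M) (u v : E) :
    fderiv ℝ (fderiv ℝ (heightIntegral h t₀ ψ ∘ (extChartAt I x).symm)) (extChartAt I x x) u v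
      = deriv h (ψ x).1 *
          ((fderiv ℝ (writtenInExtChartAt I (warpedModel n) x ψ) (extChartAt I x x) u).1 *
          (fderiv ℝ (writtenInExtChartAt I (warpedModel n) x ψ) (extChartAt I x x) v).1)
        + h (ψ x).1 * (fderiv ℝ (fderiv ℝ (writtenInExtChartAt I (warpedModel n) x ψ))
            (extChartAt I x x) u v).1 := by
  set f := writtenInExtChartAt I (warpedModel n) x ψ
  set y := extChartAt I x x
  have hC : ContDiffAt ℝ ∞ f y := contDiffAt_writtenInExtChartAt hψ x
  have hd : ∀ᶠ z in 𝓝 y, DifferentiableAt ℝ f z :=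
    ((hC.of_le (m := 1) (by simp)).eventually (by simp)).mono
      fun y hy ↦ hy.differentiableAt (by norm_num)
  have hf1 : HasFDerivAt f (fderiv ℝ f y) y := (hC.differentiableAt (by simp)).hasFDerivAt
  have hf2 : HasFDerivAt (fderiv ℝ f) (fderiv ℝ (fderiv ℝ f) y) y :=
    ((hC.fderiv_right (m := 1) (WithTop.coe_le_coe.2 (le_top : (2 : ℕ∞) ≤ ⊤))).differentiableAt
      (by norm_num)).hasFDerivAt
  have h1 : fderiv ℝ (heightIntegral h t₀ ψ ∘ (extChartAt I x).symm) =ᶠ[𝓝 y] fun z ↦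
      h (f z).1 • (ContinuousLinearMap.fst ℝ ℝ (EuclideanSpace ℝ (Fin n))).comp (fderiv ℝ f z) := by
    filter_upwards [hd] with z hz
    exact (hasFDerivAt_heightIntegral_chart hT hh.continuousOn t₀ x hz).fderiv
  have hfy : (f y).1 = (ψ x).1 := writtenInExtChartAt_fst_self x
  have hh' : HasDerivAt h (deriv h (ψ x).1) (f y).1 := by
    rw [hfy]
    exact ((hh.contDiffAt (T.isOpen.mem_nhds (ψ x).1.2)).differentiableAt (by simp)).hasDerivAt
  have h2 : HasFDerivAt (fun z ↦ h (f z).1) _ y :=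
    HasDerivAt.comp_hasFDerivAt (f := fun z ↦ (f z).1) y hh' (hasFDerivAt_fst.comp y hf1)
  have h3 : HasFDerivAt (fun z ↦
      (ContinuousLinearMap.fst ℝ ℝ (EuclideanSpace ℝ (Fin n))).comp (fderiv ℝ f z)) _ y :=
    (hasFDerivAt_const (ContinuousLinearMap.fst ℝ ℝ (EuclideanSpace ℝ (Fin n))) y).clm_comp hf2
  rw [h1.fderiv_eq, (h2.fun_smul h3).fderiv]
  simp [hfy]
  ring

end HeightIntegral

/-! ### Hessian, Laplacian and gradient of the height integral -/

section Soliton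

variable {m n : ℕ}
  {M : Type*} [TopologicalSpace M] [ChartedSpace (EuclideanSpace ℝ (Fin m)) M]
  [IsManifold 𝓘(ℝ, EuclideanSpace ℝ (Fin m)) ∞ M]
  {gM : Bundle.ContMDiffRiemannianMetric 𝓘(ℝ, EuclideanSpace ℝ (Fin m)) ∞
    (EuclideanSpace ℝ (Fin m)) (fun x : M ↦ TangentSpace 𝓘(ℝ, EuclideanSpace ℝ (Fin m)) x)}
  {P : Type*} [TopologicalSpace P] [ChartedSpace (EuclideanSpace ℝ (Fin n)) P]
  [IsManifold 𝓘(ℝ, EuclideanSpace ℝ (Fin n)) ∞ P]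
  {g₀ : Bundle.ContMDiffRiemannianMetric 𝓘(ℝ, EuclideanSpace ℝ (Fin n)) ∞
    (EuclideanSpace ℝ (Fin n)) (fun p : P ↦ TangentSpace 𝓘(ℝ, EuclideanSpace ℝ (Fin n)) p)}
  {T : Opens ℝ} {h : ℝ → ℝ} {ψ : M → T × P}

lemma eq_zero_of_inner_eq_zero {x : M} (v : TangentSpace 𝓘(ℝ, EuclideanSpace ℝ (Fin m)) x)
    (hv : gM.inner x v = 0) : v = 0 := by
  by_contra hne
  have := gM.pos x v hne
  rw [hv] at this
  exact lt_irrefl _ this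

set_option maxHeartbeats 400000 in
/-- The `∂_t`-component of the second fundamental form.  The middle term comes from
`Γᵗ(u, v) = -h h' g₀(u, v)`, the last one is the tangential part. -/
lemma secondFundamentalForm_fst (hh : ContDiffOn ℝ ∞ h T) (hpos : ∀ t ∈ T, 0 < h t)
    (hψ : IsIsometricImmersion 𝓘(ℝ, EuclideanSpace ℝ (Fin m)) (warpedModel n)
      gM.inner (warpedMetric T h g₀.inner) ψ) (x : M)
    (u v : TangentSpace 𝓘(ℝ, EuclideanSpace ℝ (Fin m)) x) :
    (secondFundamentalForm 𝓘(ℝ, EuclideanSpace ℝ (Fin m)) (warpedModel n)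
        (warpedMetric T h g₀.inner) ψ x u v).1
      = (fderiv ℝ (fderiv ℝ
            (writtenInExtChartAt 𝓘(ℝ, EuclideanSpace ℝ (Fin m)) (warpedModel n) x ψ))
            (extChartAt 𝓘(ℝ, EuclideanSpace ℝ (Fin m)) x x) u v).1
        + -(h (ψ x).1 * deriv h (ψ x).1 * g₀.inner (ψ x).2
            (mfderiv 𝓘(ℝ, EuclideanSpace ℝ (Fin m)) (warpedModel n) ψ x u).2
            (mfderiv 𝓘(ℝ, EuclideanSpace ℝ (Fin m)) (warpedModel n) ψ x v).2)
        - (mfderiv 𝓘(ℝ, EuclideanSpace ℝ (Fin m)) (warpedModel n) ψ x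
            (christoffel (F := EuclideanSpace ℝ (Fin m))
              (chartMetric 𝓘(ℝ, EuclideanSpace ℝ (Fin m)) gM.inner x)
              (extChartAt 𝓘(ℝ, EuclideanSpace ℝ (Fin m)) x x) u v)).1 := by
  have hne : h (ψ x).1 ≠ 0 := (hpos _ (ψ x).1.2).ne'
  have hdh : DifferentiableAt ℝ h (ψ x).1 :=
    (hh.contDiffAt (T.isOpen.mem_nhds (ψ x).1.2)).differentiableAt (by simp)
  have hev := eventually_chartMetric_warpedMetric (h := h) g₀.inner (ψ x)
  have hdiff := differentiableAt_chartMetric_fibre g₀ (ψ x)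
  have hsym : ∀ᶠ z in 𝓝 (extChartAt (warpedModel n) (ψ x) (ψ x)), ∀ u v,
      chartMetric (warpedModel n) (warpedMetric T h g₀.inner) (ψ x) z u v
        = chartMetric (warpedModel n) (warpedMetric T h g₀.inner) (ψ x) z v u :=
    .of_forall fun z u v ↦ warpedMetric_symm g₀ _ _ _
  have htan := hψ.tangentialPart_covDerivPush (fun v ↦ eq_zero_of_inner_eq_zero v)
    (fun v ↦ eq_zero_of_warpedMetric_eq_zero g₀ hne)
    (differentiableAt_warped hev hdh.hasDerivAt hdiff) hsym u v
  have hchr := christoffel_warped_fst hev hdh.hasDerivAt hdiff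
    (chartMetric_warpedMetric_nondegenerate g₀ hne)
    (mfderiv 𝓘(ℝ, EuclideanSpace ℝ (Fin m)) (warpedModel n) ψ x u)
    (mfderiv 𝓘(ℝ, EuclideanSpace ℝ (Fin m)) (warpedModel n) ψ x v)
  rw [secondFundamentalForm, normalPart, htan]
  refine congrArg (· - _) (congrArg (_ + ·) (hchr.trans ?_))
  refine congrArg (fun r ↦ -(h (ψ x).1 * deriv h (ψ x).1 * r)) ?_
  exact chartMetric_self g₀.inner (ψ x).2 _ _

/-- `Hess η = h' gM + ⟨II, X⟩`. -/
lemma hessian_heightIntegral (hT : (T : Set ℝ).OrdConnected) (hh : ContDiffOn ℝ ∞ h T)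
    (hpos : ∀ t ∈ T, 0 < h t) (t₀ : T)
    (hψ : IsIsometricImmersion 𝓘(ℝ, EuclideanSpace ℝ (Fin m)) (warpedModel n)
      gM.inner (warpedMetric T h g₀.inner) ψ) (x : M)
    (u v : TangentSpace 𝓘(ℝ, EuclideanSpace ℝ (Fin m)) x) :
    hessian 𝓘(ℝ, EuclideanSpace ℝ (Fin m)) gM.inner (heightIntegral h t₀ ψ) x u v
      = deriv h (ψ x).1 * gM.inner x u v
        + h (ψ x).1 * (secondFundamentalForm 𝓘(ℝ, EuclideanSpace ℝ (Fin m)) (warpedModel n)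
            (warpedMetric T h g₀.inner) ψ x u v).1 := by
  have hgM := hψ.2 x u v
  rw [warpedMetric_apply] at hgM
  have h2 := fderiv_fderiv_heightIntegral hT hh t₀ hψ.1 x u v
  have h3 := (hasFDerivAt_heightIntegral_chart hT hh.continuousOn t₀ x
    ((contDiffAt_writtenInExtChartAt hψ.1 x).differentiableAt (by simp))).fderiv
  rw [writtenInExtChartAt_fst_self] at h3
  rw [← mfderiv_eq_fderiv_writtenInExtChartAt hψ.1 x] at h2 h3
  have h4 : ∀ K : EuclideanSpace ℝ (Fin m),
      fderiv ℝ (heightIntegral h t₀ ψ ∘ (extChartAt 𝓘(ℝ, EuclideanSpace ℝ (Fin m)) x).symm)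
          (extChartAt 𝓘(ℝ, EuclideanSpace ℝ (Fin m)) x x) K
        = h (ψ x).1 * (mfderiv 𝓘(ℝ, EuclideanSpace ℝ (Fin m)) (warpedModel n) ψ x K).1 := by
    intro K
    rw [h3]
    rfl
  refine (congrArg₂ (· - ·) h2 (h4 _)).trans ?_
  rw [secondFundamentalForm_fst hh hpos hψ, ← hgM]
  have key : ∀ d r p q D G K : ℝ, d * (p * q) + r * D - r * K
      = d * (p * q + r ^ 2 * G) + r * (D + -(r * d * G) - K) := by
    intros
    ring
  exact key _ _ _ _ _ _ _

/-- `Δη = m h' + ⟨H, X⟩`. -/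
lemma laplacian_heightIntegral (hT : (T : Set ℝ).OrdConnected) (hh : ContDiffOn ℝ ∞ h T)
    (hpos : ∀ t ∈ T, 0 < h t) (t₀ : T)
    (hψ : IsIsometricImmersion 𝓘(ℝ, EuclideanSpace ℝ (Fin m)) (warpedModel n)
      gM.inner (warpedMetric T h g₀.inner) ψ) (x : M) :
    laplacian 𝓘(ℝ, EuclideanSpace ℝ (Fin m)) gM.inner (heightIntegral h t₀ ψ) x
      = m * deriv h (ψ x).1
        + h (ψ x).1 * (meanCurvature 𝓘(ℝ, EuclideanSpace ℝ (Fin m)) (warpedModel n)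
            (warpedMetric T h g₀.inner) ψ x).1 := by
  have h1 : hessian 𝓘(ℝ, EuclideanSpace ℝ (Fin m)) gM.inner (heightIntegral h t₀ ψ) x
      = fun u v ↦ deriv h (ψ x).1 * gM.inner x u v
        + h (ψ x).1 * (secondFundamentalForm 𝓘(ℝ, EuclideanSpace ℝ (Fin m)) (warpedModel n)
            (warpedMetric T h g₀.inner) ψ x u v).1 :=
    funext fun u ↦ funext fun v ↦ hessian_heightIntegral hT hh hpos t₀ hψ x u v
  have h2 := map_metricTrace (V := EuclideanSpace ℝ (Fin m))
    (AddMonoidHom.fst ℝ (EuclideanSpace ℝ (Fin n))) (gM.inner x)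
    (secondFundamentalForm 𝓘(ℝ, EuclideanSpace ℝ (Fin m)) (warpedModel n)
      (warpedMetric T h g₀.inner) ψ x)
  have h3 := metricTrace_self (V := EuclideanSpace ℝ (Fin m)) (B := gM.inner x)
    (fun v ↦ eq_zero_of_inner_eq_zero v) (gM.symm x)
  rw [finrank_euclideanSpace_fin] at h3
  rw [meanCurvature, hψ.inducedMetric_eq, laplacian, h1]
  refine (metricTrace_add (V := EuclideanSpace ℝ (Fin m)) _ _ _).trans ?_
  refine congrArg₂ (· + ·) ?_ ?_
  · refine (metricTrace_const_mul (V := EuclideanSpace ℝ (Fin m)) _ _ _).trans ?_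
    rw [mul_comm]
    exact congrArg (· * deriv h (ψ x).1) h3
  · refine (metricTrace_const_mul (V := EuclideanSpace ℝ (Fin m)) _ _ _).trans ?_
    exact congrArg (h (ψ x).1 * ·) h2.symm

omit [IsManifold 𝓘(ℝ, EuclideanSpace ℝ (Fin n)) ∞ P] in
lemma apply_grad_heightIntegral (hT : (T : Set ℝ).OrdConnected) (hh : ContDiffOn ℝ ∞ h T) (t₀ : T)
    (hψ : ContMDiff 𝓘(ℝ, EuclideanSpace ℝ (Fin m)) (warpedModel n) ∞ ψ) (x : M)
    (v : TangentSpace 𝓘(ℝ, EuclideanSpace ℝ (Fin m)) x) :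
    gM.inner x (grad 𝓘(ℝ, EuclideanSpace ℝ (Fin m)) gM.inner (heightIntegral h t₀ ψ) x) v
      = h (ψ x).1 * (mfderiv 𝓘(ℝ, EuclideanSpace ℝ (Fin m)) (warpedModel n) ψ x v).1 := by
  have h1 := apply_sharp (V := EuclideanSpace ℝ (Fin m)) (B := gM.inner x)
    (fun v ↦ eq_zero_of_inner_eq_zero v)
    (mfderiv 𝓘(ℝ, EuclideanSpace ℝ (Fin m)) 𝓘(ℝ, ℝ) (heightIntegral h t₀ ψ) x)
  have h2 := (hasMFDerivAt_heightIntegral hT hh.continuousOn t₀ hψ x).mfderiv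
  exact (DFunLike.congr_fun h1 v).trans (DFunLike.congr_fun h2 v)

/-- `X^⊤ = dψ (∇η)`. -/
lemma tangentialPart_warpedField (hT : (T : Set ℝ).OrdConnected) (hh : ContDiffOn ℝ ∞ h T) (t₀ : T)
    (hψ : IsIsometricImmersion 𝓘(ℝ, EuclideanSpace ℝ (Fin m)) (warpedModel n)
      gM.inner (warpedMetric T h g₀.inner) ψ) (x : M) :
    tangentialPart 𝓘(ℝ, EuclideanSpace ℝ (Fin m)) (warpedModel n) (warpedMetric T h g₀.inner) ψ x
        (warpedField T h (ψ x))
      = mfderiv 𝓘(ℝ, EuclideanSpace ℝ (Fin m)) (warpedModel n) ψ x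
          (grad 𝓘(ℝ, EuclideanSpace ℝ (Fin m)) gM.inner (heightIntegral h t₀ ψ) x) := by
  refine hψ.tangentialPart_eq (fun v ↦ eq_zero_of_inner_eq_zero v) fun v ↦ ?_
  rw [apply_grad_heightIntegral hT hh t₀ hψ.1, warpedMetric_symm, warpedMetric_warpedField]

omit [IsManifold 𝓘(ℝ, EuclideanSpace ℝ (Fin m)) ∞ M] in
lemma grad_const_mul {f : M → ℝ} {x : M}
    (hf : MDifferentiableAt 𝓘(ℝ, EuclideanSpace ℝ (Fin m)) 𝓘(ℝ, ℝ) f x)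
    (g : MetricTensor 𝓘(ℝ, EuclideanSpace ℝ (Fin m)) M) (a : ℝ) :
    grad 𝓘(ℝ, EuclideanSpace ℝ (Fin m)) g (fun y ↦ a * f y) x
      = a • grad 𝓘(ℝ, EuclideanSpace ℝ (Fin m)) g f x := by
  have h1 := (hf.hasMFDerivAt.const_smul a).mfderiv
  have h2 : mfderiv 𝓘(ℝ, EuclideanSpace ℝ (Fin m)) 𝓘(ℝ, ℝ) (fun y ↦ a * f y) x
      = a • mfderiv 𝓘(ℝ, EuclideanSpace ℝ (Fin m)) 𝓘(ℝ, ℝ) f x := h1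
  rw [grad, h2]
  exact map_smul ((g x).inverse) a _

end Soliton

end MCFSoliton

open MCFSoliton
theorem proposition5p1 {m n : ℕ}
    {M : Type*} [TopologicalSpace M] [ChartedSpace (EuclideanSpace ℝ (Fin m)) M]
    [IsManifold 𝓘(ℝ, EuclideanSpace ℝ (Fin m)) ∞ M]
    (gM : Bundle.ContMDiffRiemannianMetric 𝓘(ℝ, EuclideanSpace ℝ (Fin m)) ∞
      (EuclideanSpace ℝ (Fin m))
      (fun x : M ↦ TangentSpace 𝓘(ℝ, EuclideanSpace ℝ (Fin m)) x))
    {P : Type*} [TopologicalSpace P] [ChartedSpace (EuclideanSpace ℝ (Fin n)) P]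
    [IsManifold 𝓘(ℝ, EuclideanSpace ℝ (Fin n)) ∞ P]
    (g₀ : Bundle.ContMDiffRiemannianMetric 𝓘(ℝ, EuclideanSpace ℝ (Fin n)) ∞
      (EuclideanSpace ℝ (Fin n))
      (fun p : P ↦ TangentSpace 𝓘(ℝ, EuclideanSpace ℝ (Fin n)) p))
    (T : Opens ℝ) (hT : (T : Set ℝ).OrdConnected)
    (h : ℝ → ℝ) (hh : ContDiffOn ℝ ∞ h T) (hpos : ∀ t ∈ T, 0 < h t)
    (t₀ : T) (c : ℝ) (ψ : M → T × P)
    (hψ : IsMCFSoliton 𝓘(ℝ, EuclideanSpace ℝ (Fin m)) (warpedModel n)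
      gM.inner (warpedMetric T h g₀.inner) ψ (warpedField T h) c)
    (x : M) :
    (c ≠ 0 →
      laplacian 𝓘(ℝ, EuclideanSpace ℝ (Fin m)) gM.inner (heightIntegral h t₀ ψ) x
          = m * conformalFactor h g₀.inner ψ x
            + 1 / c * warpedMetric T h g₀.inner (ψ x)
                (meanCurvature 𝓘(ℝ, EuclideanSpace ℝ (Fin m)) (warpedModel n)
                  (warpedMetric T h g₀.inner) ψ x)
                (meanCurvature 𝓘(ℝ, EuclideanSpace ℝ (Fin m)) (warpedModel n)
                  (warpedMetric T h g₀.inner) ψ x) ∧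
      laplacian 𝓘(ℝ, EuclideanSpace ℝ (Fin m)) gM.inner (heightIntegral h t₀ ψ) x
          = m * deriv h (ψ x).1
            + 1 / c * warpedMetric T h g₀.inner (ψ x)
                (meanCurvature 𝓘(ℝ, EuclideanSpace ℝ (Fin m)) (warpedModel n)
                  (warpedMetric T h g₀.inner) ψ x)
                (meanCurvature 𝓘(ℝ, EuclideanSpace ℝ (Fin m)) (warpedModel n)
                  (warpedMetric T h g₀.inner) ψ x)) ∧
    weightedLaplacian 𝓘(ℝ, EuclideanSpace ℝ (Fin m)) gM.inner
        (fun y ↦ -c * heightIntegral h t₀ ψ y) (heightIntegral h t₀ ψ) x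
      = m * conformalFactor h g₀.inner ψ x
        + c * warpedMetric T h g₀.inner (ψ x) (warpedField T h (ψ x)) (warpedField T h (ψ x)) ∧
    weightedLaplacian 𝓘(ℝ, EuclideanSpace ℝ (Fin m)) gM.inner
        (fun y ↦ -c * heightIntegral h t₀ ψ y) (heightIntegral h t₀ ψ) x
      = m * deriv h (ψ x).1 + c * h (ψ x).1 ^ 2 := by
  set g := warpedMetric T h g₀.inner
  set η := heightIntegral h t₀ ψ
  set a := grad 𝓘(ℝ, EuclideanSpace ℝ (Fin m)) gM.inner η x
  set b := mfderiv 𝓘(ℝ, EuclideanSpace ℝ (Fin m)) (warpedModel n) ψ x a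
  set X : TangentSpace (warpedModel n) (ψ x) := warpedField T h (ψ x)
  set A := meanCurvature 𝓘(ℝ, EuclideanSpace ℝ (Fin m)) (warpedModel n) g ψ x
  have hiso := hψ.1
  have hne : h (ψ x).1 ≠ 0 := (hpos _ (ψ x).1.2).ne'
  have hdh : DifferentiableAt ℝ h (ψ x).1 :=
    (hh.contDiffAt (T.isOpen.mem_nhds (ψ x).1.2)).differentiableAt (by simp)
  have hφ : conformalFactor h g₀.inner ψ x = deriv h (ψ x).1 := by
    rw [conformalFactor, divergence_warpedField g₀ hdh hne]
    field_simp
  have hΔ : laplacian 𝓘(ℝ, EuclideanSpace ℝ (Fin m)) gM.inner η x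
      = m * deriv h (ψ x).1 + h (ψ x).1 * A.1 :=
    laplacian_heightIntegral hT hh hpos t₀ hiso x
  -- `b = dψ (∇η)` is the tangential part of `X`.
  have hsol : c • (X - b) = A := by
    have h1 := hψ.2 x
    rw [normalPart, tangentialPart_warpedField hT hh t₀ hiso x] at h1
    exact h1
  have hA1 : A.1 = c * (h (ψ x).1 - b.1) := congrArg Prod.fst hsol.symm
  -- `|∇η|² = |X^⊤|² = ⟨X^⊤, X⟩`, all equal to `h` times the `∂_t`-component of `X^⊤`.
  have haa : gM.inner x a a = h (ψ x).1 * b.1 := apply_grad_heightIntegral hT hh t₀ hiso.1 x a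
  have hbb : g (ψ x) b b = h (ψ x).1 * b.1 := (hiso.2 x a a).trans haa
  have hbX : g (ψ x) b X = h (ψ x).1 * b.1 := warpedMetric_warpedField g₀.inner (ψ x) b
  have hXb : g (ψ x) X b = h (ψ x).1 * b.1 := (warpedMetric_symm g₀ (ψ x) X b).trans hbX
  have hXX : g (ψ x) X X = h (ψ x).1 * h (ψ x).1 := warpedMetric_warpedField g₀.inner (ψ x) X
  have hAA : g (ψ x) A A = c ^ 2 * (h (ψ x).1 * (h (ψ x).1 - b.1)) := by
    rw [← hsol]
    simp only [map_smul, map_sub, _root_.smul_apply, _root_.sub_apply, smul_eq_mul, hbb, hbX, hXb,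
      hXX]
    ring
  have hw : weightedLaplacian 𝓘(ℝ, EuclideanSpace ℝ (Fin m)) gM.inner (fun y ↦ -c * η y) η x
      = m * deriv h (ψ x).1 + c * h (ψ x).1 ^ 2 := by
    rw [weightedLaplacian, grad_const_mul
      (hasMFDerivAt_heightIntegral hT hh.continuousOn t₀ hiso.1 x).mdifferentiableAt, hΔ, hA1,
      map_smul, _root_.smul_apply, haa, smul_eq_mul]
    ring
  have hl : c ≠ 0 → laplacian 𝓘(ℝ, EuclideanSpace ℝ (Fin m)) gM.inner η x
      = m * deriv h (ψ x).1 + 1 / c * g (ψ x) A A := by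
    intro hc
    rw [hΔ, hA1, hAA]
    field_simp
  rw [hφ, hXX, ← sq]
  exact ⟨fun hc ↦ ⟨hl hc, hl hc⟩, hw, hw⟩
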